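/- Let $N$ be a finite set of agents and $\mathcal S$ a set of outcomes; agent $i$ has a private type $t_i$ in a domain $D_i$, type $t_i$ has cost $t_i(X)\in\mathbb R$ for outcome $X$, and her utility from $X$ with payment $p_i$ is $p_i-t_i(X)$. (The single-parameter setting is the special case $D_i\subseteq\mathbb R$, $t_i(X)=t_i\,w_i(X)$ with $w_i$ public.) Let $f:\prod_i D_i\to\mathcal S$ and $k\in\{0,1,2,\dots\}\cup\{\infty\}$. **General mechanisms.** An extensive-form mechanism is a finite extensive-form game with perfect recall, possibly with imperfect information and with random moves (of positive probability) of the mechanism, whose terminal histories carry an outcome and a payment to each agent, together with a strategy $S_i(t_i)$ (an available action at each information set of $i$) for each agent $i$ and type $t_i\in D_i$. An information set $I$ of $i$ is an *earliest point of departure* between strategies $S_i,S_i'$ of $i$ if $I$ is on the path of play under both (for some behaviour of the others and of the mechanism), $S_i,S_i'$ agree at all information sets of $i$ earlier than $I$, and they differ at $I$. For type $t_i$, $S_i$ *$k$-step obviously dominates* $S_i'$ if at every such $I$ every utility that $i$ can obtain from $I$ by following $S_i$ at $I$ and at her next $k$ moves is at least every utility that she can obtain from $I$ by following $S_i'$ at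 $I$ and at her next $k$ moves, where the moves of the other agents, the random moves, and the moves of $i$ after those $k$ moves are arbitrary. The mechanism is a $k$-step OSP mechanism implementing $f$ if each $S_i(t_i)$ $k$-step obviously dominates, for type $t_i$, all other strategies of $i$ and, for every type profile $t$ and all realizations of the random moves, the play of $(S_i(t_i))_i$ ends with outcome $f(t)$. **Round-table mechanisms.** A round-table mechanism is a finite rooted tree whose leaves carry an outcome and a payment to each agent; at each internal node $u$ an agent $i=i(u)$ is queried, and the query partitions her current domain $D_i(u)$ (initially $D_i$) into at least two nonempty subdomains, one for each child of $u$, the current domains of the other agents being unchanged. A type profile $b$ is available at $u$ if $b\in\prod_j D_j(u)$; $\mathcal M(b)$ is the outcome with payments at the unique leaf at which $b$ is available. Two profiles diverge at $u$ if they are available at two different children of $u$. For $u$ with $i=i(u)$, on each path from $u$ to a leaf mark the $k$-th node after $u$ at which $i$ is queried ($u$ itself if $k=0$), or the leaf if there are fewer than $k$ such nodes; the $k$-step neighborhood of $u$ consists of the nodes on the paths from $u$ to marked nodes, endpoints included. For $a$ available at $u$ let $\Gamma_u^k(a)$ be the set of profiles $b$ available at $u$ that do not diverge from $a$ at any node of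 this neighborhood. The mechanism is $k$-step OSP if for every internal node $u$ with $i=i(u)$, all profiles $a$ available at $u$, all $b\in\Gamma_u^k(a)$ and all $c$ that diverge from $a$ at $u$, the utility of $i$ with type $a_i$ from $\mathcal M(b)$ is at least her utility with type $a_i$ from $\mathcal M(c)$. It implements $f$ if the outcome of $\mathcal M(b)$ is $f(b)$ for every profile $b$. **Theorem.** There is a $k$-step OSP extensive-form mechanism implementing $f$ if and only if there is a $k$-step OSP round-table mechanism implementing $f$. -/

import Mathlib

/-! Agents form a type `N`, the type domain of agent `i` is `D i`, outcomes form a type `S`. -/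

namespace OSP

/-! ### General extensive-form games and mechanisms -/

/-- Finite extensive-form game trees.
* `terminal X p`: the game ends with outcome `X` and payments `p`.
* `decision i I m next`: agent `i`, at (a history belonging to) her information set `I`, chooses
  one of the `m` actions `0, …, m - 1`; action `a` leads to `next a`.
* `chance m w next`: the mechanism moves at random, choosing `a` with probability `w a`.

The information sets of agent `i` are indexed by natural numbers; the information sets of
different agents are unrelated, even if they carry the same index. -/
inductive GameTree (N : Type*) (S : Type*) where
  | terminal (X : S) (p : N → ℝ) : GameTree N S
  | decision (i : N) (I : ℕ) (m : ℕ) (next : Fin m → GameTree N S) : GameTree N S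
  | chance (m : ℕ) (w : Fin m → ℝ) (next : Fin m → GameTree N S) : GameTree N S

namespace GameTree

variable {N : Type*} {S : Type*}

/-- The subtree reached after the history (sequence of moves) `h`; `none` if `h` is not a history
of the game. -/
def sub : GameTree N S → List ℕ → Option (GameTree N S)
  | G, [] => some G
  | terminal _ _, _ :: _ => none
  | decision _ _ m next, a :: h => if ha : a < m then (next ⟨a, ha⟩).sub h else none
  | chance m _ next, a :: h => if ha : a < m then (next ⟨a, ha⟩).sub h else none

/-- Agent `i` moves at the history `h`, which belongs to her information set `I`. -/
def InInfoSet (G : GameTree N S) (i : N) (I : ℕ) (h : List ℕ) : Prop :=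
  ∃ m next, G.sub h = some (decision i I m next)

open Classical in
/-- The record of agent `i` along the history `h`: the sequence of her information sets met at
proper subhistories of `h`, each with the action she took there. -/
noncomputable def record (i : N) : GameTree N S → List ℕ → List (ℕ × ℕ)
  | _, [] => []
  | terminal _ _, _ :: _ => []
  | decision j I m next, a :: h =>
      (if j = i then [(I, a)] else []) ++ (if ha : a < m then record i (next ⟨a, ha⟩) h else [])
  | chance m _ next, a :: h => if ha : a < m then record i (next ⟨a, ha⟩) h else []

/-- Perfect recall: an agent has the same record at all histories of an information set. -/
def PerfectRecall (G : GameTree N S) : Prop :=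
  ∀ i I h h', G.InInfoSet i I h → G.InInfoSet i I h' → record i G h = record i G h'

/-- Well-formed extensive-form games with perfect recall: there is an action at every decision
history, random moves have positive probabilities with sum one, the same actions are available at
all histories of an information set, and perfect recall holds. -/
structure IsGame (G : GameTree N S) : Prop where
  action_exists : ∀ h i I m next, G.sub h = some (decision i I m next) → 0 < m
  prob_pos : ∀ h m w next, G.sub h = some (chance m w next) → ∀ a, 0 < w a
  prob_sum : ∀ h m w next, G.sub h = some (chance m w next) → ∑ a, w a = 1
  same_actions : ∀ h h' i I m m' next next', G.sub h = some (decision i I m next) →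
    G.sub h' = some (decision i I m' next') → m = m'
  perfect_recall : G.PerfectRecall

/-- `σ`, a function from information sets to actions, is a strategy of agent `i`: the action
chosen at each of her information sets is available there. -/
def IsStrategy (G : GameTree N S) (i : N) (σ : ℕ → ℕ) : Prop :=
  ∀ h I m next, G.sub h = some (decision i I m next) → σ I < m

/-- All moves of agent `i` along the history `h` are those of the strategy `σ`. -/
def Follows (G : GameTree N S) (i : N) (σ : ℕ → ℕ) (h : List ℕ) : Prop :=
  ∀ g a I, g ++ [a] <+: h → G.InInfoSet i I g → a = σ I

/-- The information set `I` of agent `i` is on the path of play under `σ` (for some behaviour of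
the other agents and of the mechanism). -/
def OnPath (G : GameTree N S) (i : N) (σ : ℕ → ℕ) (I : ℕ) : Prop :=
  ∃ h, G.InInfoSet i I h ∧ G.Follows i σ h

/-- The information set `J` of agent `i` is earlier than her information set `I`. -/
def Earlier (G : GameTree N S) (i : N) (J I : ℕ) : Prop :=
  ∃ g h, G.InInfoSet i J g ∧ G.InInfoSet i I h ∧ g <+: h ∧ g ≠ h

/-- `I` is an earliest point of departure between the strategies `σ` and `σ'` of agent `i`. -/
def EarliestDeparture (G : GameTree N S) (i : N) (σ σ' : ℕ → ℕ) (I : ℕ) : Prop :=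
  G.OnPath i σ I ∧ G.OnPath i σ' I ∧ (∀ J, G.Earlier i J I → σ J = σ' J) ∧ σ I ≠ σ' I

open Classical in
/-- The pairs (outcome, payments) that can be reached in the tree when agent `i` follows `σ` in
her first `k` moves and anything may happen otherwise: arbitrary moves of the other agents and of
the mechanism, and arbitrary moves of `i` from her `(k+1)`-st move on. -/
def outcomes (i : N) (σ : ℕ → ℕ) : ℕ∞ → GameTree N S → Set (S × (N → ℝ))
  | _, terminal X p => {(X, p)}
  | k, decision j I m next =>
      {o | ∃ a : Fin m, (j = i → k ≠ 0 → (a : ℕ) = σ I) ∧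
        o ∈ outcomes i σ (if j = i then k - 1 else k) (next a)}
  | k, chance _ _ next => {o | ∃ a, o ∈ outcomes i σ k (next a)}

/-- The pairs (outcome, payments) reachable from the information set `I` when `i` follows `σ` at
`I` and at her next `k` moves after `I`. -/
def outcomesFrom (G : GameTree N S) (i : N) (σ : ℕ → ℕ) (k : ℕ∞) (I : ℕ) :
    Set (S × (N → ℝ)) :=
  {o | ∃ (h : List ℕ) (m : ℕ) (next : Fin m → GameTree N S) (a : Fin m),
    G.sub h = some (decision i I m next) ∧ (a : ℕ) = σ I ∧ o ∈ outcomes i σ k (next a)}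

/-- For an agent `i` with cost function `c`, the strategy `σ` `k`-step obviously dominates `σ'`:
at every earliest point of departure, the best that can happen with `σ'` is weakly worse than the
worst that can happen with `σ`. -/
def KStepObviouslyDominates (G : GameTree N S) (i : N) (c : S → ℝ) (k : ℕ∞)
    (σ σ' : ℕ → ℕ) : Prop :=
  ∀ I, G.EarliestDeparture i σ σ' I →
    ∀ o ∈ G.outcomesFrom i σ k I, ∀ o' ∈ G.outcomesFrom i σ' k I,
      o'.2 i - c o'.1 ≤ o.2 i - c o.1

/-- The pairs (outcome, payments) that result, over all realizations of the random moves of the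
mechanism, when the agents play the strategy profile `σ`. -/
def plays (σ : N → ℕ → ℕ) : GameTree N S → Set (S × (N → ℝ))
  | terminal X p => {(X, p)}
  | decision j I m next => {o | ∃ a : Fin m, (a : ℕ) = σ j I ∧ o ∈ plays σ (next a)}
  | chance _ _ next => {o | ∃ a, o ∈ plays σ (next a)}

end GameTree

/-- An extensive-form mechanism: an extensive-form game with perfect recall, together with a
strategy of every agent for each of her types. -/
structure Mechanism (N : Type*) (D : N → Type*) (S : Type*) where
  game : GameTree N S
  isGame : game.IsGame
  strategy : ∀ i, D i → ℕ → ℕ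
  isStrategy : ∀ i t, game.IsStrategy i (strategy i t)

namespace Mechanism

variable {N : Type*} {D : N → Type*} {S : Type*}

/-- The mechanism selects `f t` for every type profile `t`, whatever its random choices. -/
def Implements (M : Mechanism N D S) (f : (∀ i, D i) → S) : Prop :=
  ∀ t : ∀ i, D i, ∀ o ∈ M.game.plays (fun i => M.strategy i (t i)), o.1 = f t

/-- For each type of each agent, the strategy prescribed by the mechanism `k`-step obviously
dominates every other strategy. Here `cost i t X` is the cost of `X` for agent `i` of type `t`. -/
def KStepOSP (M : Mechanism N D S) (cost : ∀ i, D i → S → ℝ) (k : ℕ∞) : Prop :=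
  ∀ i t σ', M.game.IsStrategy i σ' →
    M.game.KStepObviouslyDominates i (cost i t) k (M.strategy i t) σ'

end Mechanism

/-! ### Round-table mechanisms -/

/-- Implementation trees. `leaf X p` is a leaf with outcome `X` and payments `p`; at
`query i m part child` agent `i` is queried, and her answer `a` signals that her type belongs to
the subdomain `part a` and leads to `child a`. -/
inductive QueryTree (N : Type*) (D : N → Type*) (S : Type*) where
  | leaf (X : S) (p : N → ℝ) : QueryTree N D S
  | query (i : N) (m : ℕ) (part : Fin m → Set (D i)) (child : Fin m → QueryTree N D S) :
      QueryTree N D S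

namespace QueryTree

variable {N : Type*} {D : N → Type*} {S : Type*}

open Classical in
/-- Every query of the tree partitions the current domain of the queried agent into at least two
(nonempty) subdomains; `E i` is the current domain of agent `i` at the root of the tree. -/
def IsRoundTableOn : (∀ i, Set (D i)) → QueryTree N D S → Prop
  | _, leaf _ _ => True
  | E, query i m part child =>
      2 ≤ m ∧ (∀ a, (part a).Nonempty) ∧ (∀ a b, a ≠ b → Disjoint (part a) (part b)) ∧
      (⋃ a, part a) = E i ∧ ∀ a, IsRoundTableOn (Function.update E i (part a)) (child a)

/-- The tree is that of a round-table mechanism for the full type domains. -/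
def IsRoundTable (T : QueryTree N D S) : Prop := T.IsRoundTableOn (fun _ => Set.univ)

/-- The subtree at the node `u`, a node being the sequence of answers that leads to it; `none` if
there is no such node. -/
def sub : QueryTree N D S → List ℕ → Option (QueryTree N D S)
  | T, [] => some T
  | leaf _ _, _ :: _ => none
  | query _ m _ child, a :: u => if ha : a < m then (child ⟨a, ha⟩).sub u else none

/-- `u` is a node at which agent `i` is queried. -/
def Queried (T : QueryTree N D S) (i : N) (u : List ℕ) : Prop :=
  ∃ m part child, T.sub u = some (query i m part child)

/-- `u` is a leaf. -/
def IsLeaf (T : QueryTree N D S) (u : List ℕ) : Prop := ∃ X p, T.sub u = some (leaf X p)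

/-- The type profile `b` is compatible with (available at) the node `u`. -/
def Available (b : ∀ i, D i) : QueryTree N D S → List ℕ → Prop
  | _, [] => True
  | leaf _ _, _ :: _ => False
  | query i m part child, a :: u =>
      ∃ ha : a < m, b i ∈ part ⟨a, ha⟩ ∧ Available b (child ⟨a, ha⟩) u

/-- The mechanism ends with outcome `X` and payments `p` on the type profile `b`. -/
def Result (T : QueryTree N D S) (b : ∀ i, D i) (X : S) (p : N → ℝ) : Prop :=
  ∃ u, T.sub u = some (leaf X p) ∧ T.Available b u

/-- The profiles `a` and `b` diverge (are separated) at the node `u`: they are available at two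
different children of `u`. -/
def Diverge (T : QueryTree N D S) (u : List ℕ) (a b : ∀ i, D i) : Prop :=
  ∃ x y, x ≠ y ∧ T.Available a (u ++ [x]) ∧ T.Available b (u ++ [y])

/-- The number of nodes on the path from `u` (excluded) to `v` (included) at which agent `i` is
queried. -/
noncomputable def numQueries (T : QueryTree N D S) (i : N) (u v : List ℕ) : ℕ :=
  Set.ncard {w | u <+: w ∧ u ≠ w ∧ w <+: v ∧ T.Queried i w}

/-- `v` belongs to the `k`-step limit of the node `u`, at which `i` is queried: on a path from `u`
to a leaf, `v` is the `k`-th node after `u` at which `i` is queried, or it is the leaf if `i` is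
queried fewer than `k` times after `u`. -/
def InLimit (T : QueryTree N D S) (i : N) (k : ℕ∞) (u v : List ℕ) : Prop :=
  u <+: v ∧ ((T.Queried i v ∧ (T.numQueries i u v : ℕ∞) = k) ∨
    (T.IsLeaf v ∧ (T.numQueries i u v : ℕ∞) < k))

/-- `v` belongs to the `k`-step neighborhood of the node `u`, at which `i` is queried. -/
def InNeighborhood (T : QueryTree N D S) (i : N) (k : ℕ∞) (u v : List ℕ) : Prop :=
  ∃ v', T.InLimit i k u v' ∧ u <+: v ∧ v <+: v'

/-- The `k`-step equivalence class, at the node `u` at which `i` is queried, of a profile `a`: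
the profiles available at `u` that are not separated from `a` in the `k`-step neighborhood
of `u` (to which `u` itself belongs). -/
def equivClass (T : QueryTree N D S) (i : N) (k : ℕ∞) (u : List ℕ) (a : ∀ i, D i) :
    Set (∀ i, D i) :=
  {b | T.Available b u ∧ ¬ T.Diverge u a b ∧ ∀ v, T.InNeighborhood i k u v → ¬ T.Diverge v a b}

/-- The round-table mechanism selects `f b` for every type profile `b`. -/
def Implements (T : QueryTree N D S) (f : (∀ i, D i) → S) : Prop :=
  ∀ b, ∃ p, T.Result b (f b) p

/-- `k`-step OSP for round-table mechanisms. The true type of agent `i` is `a i`. -/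
def KStepOSP (T : QueryTree N D S) (cost : ∀ i, D i → S → ℝ) (k : ℕ∞) : Prop :=
  ∀ i u, T.Queried i u → ∀ a b c : ∀ i, D i,
    T.Available a u → b ∈ T.equivClass i k u a → T.Diverge u a c →
    ∀ X p X' p', T.Result b X p → T.Result c X' p' →
      p' i - cost i (a i) X' ≤ p i - cost i (a i) X

end QueryTree

end OSP


/-! Both kinds of mechanism are compared through the set of results that remain possible when one
agent plays according to her type in her next `k` moves while everything else is arbitrary. In an
extensive-form game this set is `GameTree.outcomes`. In a round-table tree `QueryTree.outcomes` is
defined by the same recursion, and `QueryTree.kStepOSP_iff` rephrases `k`-step OSP in terms of it: a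
profile indistinguishable from `a` in the `k`-step neighborhood of `u` is precisely one for which
agent `i(u)` answers as type `a_i` would at `u` and at her next `k` queries.

A round-table tree becomes a game with perfect information in which truthful answers are the
prescribed strategies. Conversely, given a mechanism, query at every decision node which action the
prescribed strategy takes; nodes at which all current types of the agent take the same action are
skipped, and chance nodes are replaced by an arbitrary branch. In both cases results possible on one
side are possible on the other by induction on the tree. Perfect recall enters only to see that two
types separated by a query have strategies whose earliest point of departure is the information set
of that query. -/

namespace OSP

variable {N : Type*} {D : N → Type*} {S : Type*}

open Classical in
/-- The number of moves that agent `i` still has to make as prescribed after a move of agent `j`,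
if it was `k` before that move. -/
noncomputable def remaining (i j : N) (k : ℕ∞) : ℕ∞ := if j = i then k - 1 else k

@[simp]
theorem remaining_self (i : N) (k : ℕ∞) : remaining i i k = k - 1 := if_pos rfl

theorem remaining_of_ne {i j : N} (h : j ≠ i) (k : ℕ∞) : remaining i j k = k := if_neg h

@[simp]
theorem remaining_zero (i j : N) : remaining i j 0 = 0 := by
  by_cases h : j = i <;> simp [remaining, h]

theorem remaining_self_add_one (i : N) (k : ℕ∞) : remaining i i (k + 1) = k := by
  rw [remaining_self, (ENat.addLECancellable_of_ne_top ENat.one_ne_top).add_tsub_cancel_right]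

theorem remaining_ne_zero {i j : N} {k : ℕ∞} (h : remaining i j k ≠ 0) : k ≠ 0 := by
  rintro rfl
  exact h (remaining_zero i j)

theorem remaining_le (i j : N) (k : ℕ∞) : remaining i j k ≤ k := by
  unfold remaining
  split_ifs
  exacts [tsub_le_self, le_rfl]

theorem remaining_mono (i j : N) : Monotone (remaining i j) := by
  intro k l hkl
  by_cases h : j = i
  · subst h
    simpa using tsub_le_tsub_right hkl 1
  · simpa [remaining_of_ne h] using hkl

theorem exists_concat_prefix_cons_iff {α : Type*} {P : List α → Prop} {x y : α} {h : List α} :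
    (∃ g, g ++ [x] <+: y :: h ∧ P g) ↔ x = y ∧ P [] ∨ ∃ g, g ++ [x] <+: h ∧ P (y :: g) := by
  constructor
  · rintro ⟨_ | ⟨z, g⟩, hg, hP⟩
    · exact .inl ⟨(List.cons_prefix_cons.1 hg).1, hP⟩
    · obtain ⟨rfl, hg'⟩ := List.cons_prefix_cons.1 hg
      exact .inr ⟨g, hg', hP⟩
  · rintro (⟨rfl, hP⟩ | ⟨g, hg, hP⟩)
    · exact ⟨[], by simp, hP⟩
    · exact ⟨y :: g, List.cons_prefix_cons.2 ⟨rfl, hg⟩, hP⟩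

namespace GameTree

/-! ### Histories and records -/

theorem sub_decision_cons (i : N) (I : ℕ) {m : ℕ} (next : Fin m → GameTree N S) (a : Fin m)
    (h : List ℕ) : (decision i I m next).sub (a :: h) = (next a).sub h := by
  simp [sub]

theorem sub_chance_cons {m : ℕ} (w : Fin m → ℝ) (next : Fin m → GameTree N S) (a : Fin m)
    (h : List ℕ) : (chance m w next).sub (a :: h) = (next a).sub h := by
  simp [sub]

theorem IsGame.chance_pos {G : GameTree N S} (hG : G.IsGame) {h : List ℕ} {m : ℕ}
    {w : Fin m → ℝ} {next : Fin m → GameTree N S} (hs : G.sub h = some (chance m w next)) :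
    0 < m := by
  rcases Nat.eq_zero_or_pos m with rfl | hm
  · simpa using hG.prob_sum h 0 w next hs
  · exact hm

theorem inInfoSet_nil_decision {i j : N} {I J m : ℕ} {next : Fin m → GameTree N S} :
    (decision j I m next).InInfoSet i J [] ↔ j = i ∧ I = J := by
  constructor
  · rintro ⟨m', next', h⟩
    simp only [sub, Option.some.injEq, decision.injEq] at h
    exact ⟨h.1, h.2.1⟩
  · rintro ⟨rfl, rfl⟩
    exact ⟨m, next, rfl⟩

theorem mem_record {i : N} {J x : ℕ} {h : List ℕ} {G : GameTree N S} :
    (J, x) ∈ record i G h ↔ ∃ g, g ++ [x] <+: h ∧ G.InInfoSet i J g := by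
  induction h generalizing G with
  | nil => cases G <;> simp [record]
  | cons y h ih =>
    rw [exists_concat_prefix_cons_iff]
    cases G with
    | terminal X p => simp [record, InInfoSet, sub]
    | decision j I m next =>
      rw [inInfoSet_nil_decision]
      by_cases hy : y < m
      · have hmem : (∃ g, g ++ [x] <+: h ∧ (decision j I m next).InInfoSet i J (y :: g)) ↔
            (J, x) ∈ record i (next ⟨y, hy⟩) h := by
          simp [ih, InInfoSet, sub, hy]
        by_cases hj : j = i
        · subst hj
          simp [record, hy, hmem, eq_comm, and_comm]
        · simp [record, hy, hj, hmem]
      · by_cases hj : j = i <;> simp [record, hy, hj, InInfoSet, sub, eq_comm, and_comm]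
    | chance m w next =>
      by_cases hy : y < m <;> simp [record, hy, ih, InInfoSet, sub]

theorem follows_iff_record {G : GameTree N S} {i : N} {σ : ℕ → ℕ} {h : List ℕ} :
    G.Follows i σ h ↔ ∀ I x, (I, x) ∈ record i G h → x = σ I := by
  simp only [mem_record, Follows]
  exact ⟨fun hf I x ⟨g, hg, hI⟩ => hf g x I hg hI, fun hr g x I hg hI => hr I x ⟨g, hg, hI⟩⟩

theorem follows_nil (G : GameTree N S) (i : N) (σ : ℕ → ℕ) : G.Follows i σ [] := by
  intro g a I hg
  simp at hg

theorem follows_decision_cons_iff {i j : N} {I m : ℕ} {next : Fin m → GameTree N S} {σ : ℕ → ℕ}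
    {x : Fin m} {h : List ℕ} :
    (decision j I m next).Follows i σ (x :: h) ↔
      (j = i → (x : ℕ) = σ I) ∧ (next x).Follows i σ h := by
  by_cases hj : j = i <;> simp [follows_iff_record, record, hj, or_imp, forall_and]

theorem follows_chance_cons_iff {i : N} {m : ℕ} {w : Fin m → ℝ} {next : Fin m → GameTree N S}
    {σ : ℕ → ℕ} {x : Fin m} {h : List ℕ} :
    (chance m w next).Follows i σ (x :: h) ↔ (next x).Follows i σ h := by
  simp [follows_iff_record, record]

theorem PerfectRecall.eq_of_earlier {G : GameTree N S} (hG : G.PerfectRecall) {i : N}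
    {σ σ' : ℕ → ℕ} {I J : ℕ} {h : List ℕ} (hI : G.InInfoSet i I h) (hσ : G.Follows i σ h)
    (hσ' : G.Follows i σ' h) (hJI : G.Earlier i J I) : σ J = σ' J := by
  obtain ⟨g, h', hJ, hI', ⟨r, rfl⟩, hne⟩ := hJI
  obtain ⟨x, r, rfl⟩ := List.exists_cons_of_ne_nil (l := r) (by rintro rfl; simp at hne)
  have hx : (J, x) ∈ record i G h := by
    rw [hG i I _ _ hI hI']
    exact mem_record.2 ⟨g, ⟨r, by simp⟩, hJ⟩
  rw [← follows_iff_record.1 hσ J x hx, ← follows_iff_record.1 hσ' J x hx]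

/-! ### Outcomes of a game -/

theorem mem_outcomes_decision {i j : N} {σ : ℕ → ℕ} {k : ℕ∞} {I m : ℕ}
    {next : Fin m → GameTree N S} {o : S × (N → ℝ)} :
    o ∈ outcomes i σ k (decision j I m next) ↔
      ∃ a : Fin m, (j = i → k ≠ 0 → (a : ℕ) = σ I) ∧
        o ∈ outcomes i σ (remaining i j k) (next a) :=
  Iff.rfl

theorem outcomes_subset_zero (i : N) (σ σ' : ℕ → ℕ) (k : ℕ∞) (G : GameTree N S) :
    outcomes i σ k G ⊆ outcomes i σ' 0 G := by
  intro o ho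
  induction G generalizing k with
  | terminal X p => exact ho
  | decision j I m next ih =>
    obtain ⟨a, -, ho⟩ := mem_outcomes_decision.1 ho
    refine mem_outcomes_decision.2 ⟨a, fun _ h => absurd rfl h, ?_⟩
    rw [remaining_zero]
    exact ih a _ ho
  | chance m w next ih =>
    obtain ⟨a, ho⟩ := ho
    exact ⟨a, ih a k ho⟩

theorem plays_subset_outcomes (i : N) (σ : N → ℕ → ℕ) (k : ℕ∞) (G : GameTree N S) :
    plays σ G ⊆ outcomes i (σ i) k G := by
  intro o ho
  induction G generalizing k with
  | terminal X p => exact ho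
  | decision j I m next ih =>
    obtain ⟨a, ha, ho⟩ := ho
    exact ⟨a, by rintro rfl _; exact ha, ih a _ ho⟩
  | chance m w next ih =>
    obtain ⟨a, ho⟩ := ho
    exact ⟨a, ih a k ho⟩

theorem mem_outcomesFrom_iff {G : GameTree N S} {i : N} {σ : ℕ → ℕ} {k : ℕ∞} {I : ℕ}
    {o : S × (N → ℝ)} : o ∈ G.outcomesFrom i σ k I ↔
      ∃ h m next, G.sub h = some (decision i I m next) ∧
        o ∈ outcomes i σ (k + 1) (decision i I m next) := by
  constructor
  · rintro ⟨h, m, next, a, hs, ha, ho⟩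
    exact ⟨h, m, next, hs, a, fun _ _ => ha, by rwa [← remaining_self_add_one i k] at ho⟩
  · rintro ⟨h, m, next, hs, a, ha, ho⟩
    refine ⟨h, m, next, a, hs, ha rfl (by simp), ?_⟩
    rwa [← remaining_self_add_one i k]

end GameTree

/-! ### Products of type domains -/

theorem mem_pi_update_iff [DecidableEq N] {E : ∀ i, Set (D i)} {i : N} {P : Set (D i)}
    (hP : P ⊆ E i) {b : ∀ i, D i} :
    b ∈ Set.univ.pi (Function.update E i P) ↔ b ∈ Set.univ.pi E ∧ b i ∈ P := by
  simp only [Set.mem_univ_pi, Function.forall_update_iff E fun j s => b j ∈ s]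
  constructor
  · rintro ⟨hi, hne⟩
    refine ⟨fun j => ?_, hi⟩
    by_cases hj : j = i
    · subst hj
      exact hP hi
    · exact hne j hj
  · exact fun ⟨hE, hi⟩ => ⟨hi, fun j _ => hE j⟩

theorem nonempty_pi_update [DecidableEq N] {E : ∀ i, Set (D i)} {i : N} {P : Set (D i)}
    (hE : (Set.univ.pi E).Nonempty) (hP : P.Nonempty) :
    (Set.univ.pi (Function.update E i P)).Nonempty := by
  simp only [Set.univ_pi_nonempty_iff, Function.forall_update_iff E fun _ s => s.Nonempty]
  exact ⟨hP, fun j _ => Set.univ_pi_nonempty_iff.1 hE j⟩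

theorem mem_update_of_remaining_ne_zero [DecidableEq N] {E : ∀ i, Set (D i)} {i j : N}
    {P : Set (D j)} {a : ∀ i, D i} {k : ℕ∞} (hE : k ≠ 0 → a i ∈ E i)
    (hP : j = i → k ≠ 0 → a j ∈ P) (hk : remaining i j k ≠ 0) :
    a i ∈ Function.update E j P i := by
  by_cases hj : j = i
  · subst hj
    simpa using hP rfl (remaining_ne_zero hk)
  · rw [Function.update_of_ne (Ne.symm hj)]
    exact hE (remaining_ne_zero hk)

namespace QueryTree

/-! ### Nodes, available profiles and results -/

@[simp]
theorem sub_nil (T : QueryTree N D S) : T.sub [] = some T := by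
  cases T <;> rfl

@[simp]
theorem available_nil (T : QueryTree N D S) (b : ∀ i, D i) : T.Available b [] := by
  cases T <;> trivial

theorem sub_query_cons {j : N} {m : ℕ} {part : Fin m → Set (D j)}
    {child : Fin m → QueryTree N D S} (x : Fin m) (u : List ℕ) :
    (query j m part child).sub (x :: u) = (child x).sub u := by
  simp [sub]

theorem available_query_cons {j : N} {m : ℕ} {part : Fin m → Set (D j)}
    {child : Fin m → QueryTree N D S} {b : ∀ i, D i} {x : Fin m} {u : List ℕ} :
    (query j m part child).Available b (x :: u) ↔ b j ∈ part x ∧ (child x).Available b u := by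
  simp [Available]

theorem sub_induction {T' : QueryTree N D S}
    {motive : ∀ T : QueryTree N D S, ∀ u, T.sub u = some T' → Prop}
    (nil : motive T' [] (sub_nil T'))
    (cons : ∀ {j m part child} {x : Fin m} {u} (h : (child x).sub u = some T'),
      motive (child x) u h →
        motive (query j m part child) (x :: u) ((sub_query_cons x u).trans h))
    {T : QueryTree N D S} {u : List ℕ} (h : T.sub u = some T') : motive T u h := by
  induction u generalizing T with
  | nil =>
    obtain rfl : T = T' := by simpa using h
    exact nil
  | cons x u ih =>
    cases T with
    | leaf X p => simp [sub] at h
    | query j m part child =>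
      by_cases hx : x < m
      · lift x to Fin m using hx
        exact cons _ (ih ((sub_query_cons x u).symm.trans h))
      · simp [sub, hx] at h

theorem Available.exists_sub {T : QueryTree N D S} {b : ∀ i, D i} {u : List ℕ}
    (h : T.Available b u) : ∃ T', T.sub u = some T' := by
  induction u generalizing T with
  | nil => exact ⟨T, sub_nil T⟩
  | cons x u ih =>
    cases T with
    | leaf X p => exact h.elim
    | query j m part child =>
      obtain ⟨hx, -, hb⟩ := h
      obtain ⟨T', hT'⟩ := ih hb
      exact ⟨T', (sub_query_cons ⟨x, hx⟩ u).trans hT'⟩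

theorem sub_append {T T' : QueryTree N D S} {u : List ℕ} (h : T.sub u = some T') (v : List ℕ) :
    T.sub (u ++ v) = T'.sub v := by
  induction h using sub_induction with
  | nil => rfl
  | cons _ ih => rw [List.cons_append, sub_query_cons, ih]

theorem available_append {T T' : QueryTree N D S} {u : List ℕ} (h : T.sub u = some T')
    {b : ∀ i, D i} {v : List ℕ} :
    T.Available b (u ++ v) ↔ T.Available b u ∧ T'.Available b v := by
  induction h using sub_induction with
  | nil => simp
  | cons _ ih => rw [List.cons_append, available_query_cons, available_query_cons, ih, and_assoc]

theorem queried_append {T T' : QueryTree N D S} {i : N} {u v : List ℕ} (h : T.sub u = some T') :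
    T.Queried i (u ++ v) ↔ T'.Queried i v := by
  simp only [Queried, sub_append h]

theorem isLeaf_append {T T' : QueryTree N D S} {u v : List ℕ} (h : T.sub u = some T') :
    T.IsLeaf (u ++ v) ↔ T'.IsLeaf v := by
  simp only [IsLeaf, sub_append h]

theorem diverge_append {T T' : QueryTree N D S} {u v : List ℕ} {a b : ∀ i, D i}
    (h : T.sub u = some T') (ha : T.Available a u) (hb : T.Available b u) :
    T.Diverge (u ++ v) a b ↔ T'.Diverge v a b := by
  simp only [Diverge, List.append_assoc, available_append h, ha, hb, true_and]

theorem diverge_iff_of_sub {T T' : QueryTree N D S} {u : List ℕ} {a b : ∀ i, D i}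
    (h : T.sub u = some T') :
    T.Diverge u a b ↔ T.Available a u ∧ T.Available b u ∧ T'.Diverge [] a b := by
  simp only [Diverge, available_append h, List.nil_append]
  tauto

theorem queried_query_nil_iff {i j : N} {m : ℕ} {part : Fin m → Set (D j)}
    {child : Fin m → QueryTree N D S} : (query j m part child).Queried i [] ↔ j = i := by
  constructor
  · rintro ⟨m', part', child', h⟩
    simp only [sub_nil, Option.some.injEq, query.injEq] at h
    exact h.1
  · rintro rfl
    exact ⟨m, part, child, rfl⟩

theorem queried_query_cons_iff {i j : N} {m : ℕ} {part : Fin m → Set (D j)}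
    {child : Fin m → QueryTree N D S} {x : Fin m} {v : List ℕ} :
    (query j m part child).Queried i (x :: v) ↔ (child x).Queried i v := by
  simp only [Queried, sub_query_cons]

theorem not_queried_leaf (i : N) (X : S) (p : N → ℝ) (v : List ℕ) :
    ¬ (leaf X p : QueryTree N D S).Queried i v := by
  rintro ⟨m, part, child, h⟩
  cases v <;> simp [sub] at h

theorem IsLeaf.not_queried {T : QueryTree N D S} {v : List ℕ} (h : T.IsLeaf v) (i : N) :
    ¬ T.Queried i v := by
  rintro ⟨m, part, child, hq⟩
  obtain ⟨X, p, hl⟩ := h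
  simp [hl] at hq

theorem diverge_query_nil_iff {j : N} {m : ℕ} {part : Fin m → Set (D j)}
    {child : Fin m → QueryTree N D S} {a b : ∀ i, D i} :
    (query j m part child).Diverge [] a b ↔ ∃ x y, x ≠ y ∧ a j ∈ part x ∧ b j ∈ part y := by
  constructor
  · rintro ⟨x, y, hxy, ⟨hx, ha, -⟩, ⟨hy, hb, -⟩⟩
    exact ⟨⟨x, hx⟩, ⟨y, hy⟩, by simpa using hxy, ha, hb⟩
  · rintro ⟨x, y, hxy, ha, hb⟩
    exact ⟨x, y, by simpa [Fin.ext_iff] using hxy, available_query_cons.2 ⟨ha, available_nil _ _⟩,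
      available_query_cons.2 ⟨hb, available_nil _ _⟩⟩

theorem diverge_query_cons_iff {j : N} {m : ℕ} {part : Fin m → Set (D j)}
    {child : Fin m → QueryTree N D S} {a b : ∀ i, D i} {x : Fin m} {v : List ℕ} :
    (query j m part child).Diverge (x :: v) a b ↔
      a j ∈ part x ∧ b j ∈ part x ∧ (child x).Diverge v a b := by
  simp only [Diverge, List.cons_append, available_query_cons]
  tauto

theorem result_leaf_iff {X Y : S} {p q : N → ℝ} {b : ∀ i, D i} :
    (leaf X p : QueryTree N D S).Result b Y q ↔ Y = X ∧ q = p := by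
  constructor
  · rintro ⟨_ | ⟨x, u⟩, hs, -⟩
    · simpa [eq_comm] using hs
    · simp [sub] at hs
  · rintro ⟨rfl, rfl⟩
    exact ⟨[], rfl, trivial⟩

theorem result_query_iff {j : N} {m : ℕ} {part : Fin m → Set (D j)}
    {child : Fin m → QueryTree N D S} {b : ∀ i, D i} {X : S} {p : N → ℝ} :
    (query j m part child).Result b X p ↔ ∃ x, b j ∈ part x ∧ (child x).Result b X p := by
  constructor
  · rintro ⟨_ | ⟨x, u⟩, hs, hb⟩
    · simp at hs
    · obtain ⟨hx, hbx, hb⟩ := hb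
      exact ⟨⟨x, hx⟩, hbx, u, (sub_query_cons ⟨x, hx⟩ u).symm.trans hs, hb⟩
  · rintro ⟨x, hbx, u, hs, hb⟩
    exact ⟨x :: u, by rwa [sub_query_cons], available_query_cons.2 ⟨hbx, hb⟩⟩

/-! ### Round-table trees -/

namespace IsRoundTableOn

section Query

variable {E : ∀ i, Set (D i)} {j : N} {m : ℕ} {part : Fin m → Set (D j)}
  {child : Fin m → QueryTree N D S} (hT : IsRoundTableOn E (query j m part child))

include hT

theorem two_le : 2 ≤ m := hT.1

theorem part_nonempty (x : Fin m) : (part x).Nonempty := hT.2.1 x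

theorem eq_of_mem_part {t : D j} {x y : Fin m} (hx : t ∈ part x) (hy : t ∈ part y) : x = y := by
  by_contra hne
  exact Set.disjoint_left.1 (hT.2.2.1 x y hne) hx hy

theorem exists_mem_part {t : D j} (ht : t ∈ E j) : ∃ x, t ∈ part x := by
  rwa [← hT.2.2.2.1, Set.mem_iUnion] at ht

theorem part_subset (x : Fin m) : part x ⊆ E j :=
  hT.2.2.2.1 ▸ Set.subset_iUnion part x

open Classical in
theorem isRoundTableOn_child (x : Fin m) :
    IsRoundTableOn (Function.update E j (part x)) (child x) :=
  hT.2.2.2.2 x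

end Query

theorem exists_domains {E : ∀ i, Set (D i)} {T T' : QueryTree N D S} {u : List ℕ}
    (hT : T.IsRoundTableOn E) (h : T.sub u = some T') : ∃ E', T'.IsRoundTableOn E' ∧
      ∀ b, b ∈ Set.univ.pi E' ↔ b ∈ Set.univ.pi E ∧ T.Available b u := by
  classical
  induction h using sub_induction generalizing E with
  | nil => exact ⟨E, hT, by simp⟩
  | @cons j m part child x u _ ih =>
    obtain ⟨E', hT', hE'⟩ := ih (hT.isRoundTableOn_child x)
    refine ⟨E', hT', fun b => ?_⟩
    rw [hE', mem_pi_update_iff (hT.part_subset x), available_query_cons, and_assoc]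

theorem exists_isLeaf {E : ∀ i, Set (D i)} {T : QueryTree N D S} (hT : T.IsRoundTableOn E) :
    ∃ v, T.IsLeaf v := by
  induction T generalizing E with
  | leaf X p => exact ⟨[], X, p, rfl⟩
  | query j m part child ih =>
    have hm : 0 < m := zero_lt_two.trans_le hT.two_le
    obtain ⟨v, X, p, hv⟩ := ih ⟨0, hm⟩ (hT.isRoundTableOn_child _)
    exact ⟨_ :: v, X, p, (sub_query_cons ⟨0, hm⟩ v).trans hv⟩

theorem exists_isLeaf_append {E : ∀ i, Set (D i)} {T : QueryTree N D S}
    (hT : T.IsRoundTableOn E) {a : ∀ i, D i} {u : List ℕ} (ha : T.Available a u) :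
    ∃ v, T.IsLeaf (u ++ v) := by
  obtain ⟨T', h⟩ := ha.exists_sub
  obtain ⟨E', hT', -⟩ := hT.exists_domains h
  exact hT'.exists_isLeaf.imp fun v => (isLeaf_append h).2

theorem exists_result {E : ∀ i, Set (D i)} {T : QueryTree N D S} (hT : T.IsRoundTableOn E)
    {b : ∀ i, D i} (hb : b ∈ Set.univ.pi E) : ∃ X p, T.Result b X p := by
  classical
  induction T generalizing E with
  | leaf X p => exact ⟨X, p, result_leaf_iff.2 ⟨rfl, rfl⟩⟩
  | query j m part child ih =>
    obtain ⟨x, hx⟩ := hT.exists_mem_part (hb j trivial)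
    obtain ⟨X, p, hr⟩ := ih x (hT.isRoundTableOn_child x)
      ((mem_pi_update_iff (hT.part_subset x)).2 ⟨hb, hx⟩)
    exact ⟨X, p, result_query_iff.2 ⟨x, hx, hr⟩⟩

theorem result_iff_of_sub {E : ∀ i, Set (D i)} {T T' : QueryTree N D S} {u : List ℕ}
    (hT : T.IsRoundTableOn E) (h : T.sub u = some T') {b : ∀ i, D i} (hb : T.Available b u) {X : S}
    {p : N → ℝ} : T.Result b X p ↔ T'.Result b X p := by
  induction h using sub_induction generalizing E with
  | nil => rfl
  | @cons j m part child x u _ ih =>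
    obtain ⟨hbx, hb⟩ := available_query_cons.1 hb
    rw [result_query_iff, ← ih (hT.isRoundTableOn_child x) hb]
    constructor
    · rintro ⟨y, hby, hr⟩
      rwa [hT.eq_of_mem_part hbx hby]
    · exact fun hr => ⟨x, hbx, hr⟩

theorem result_unique {E : ∀ i, Set (D i)} {T : QueryTree N D S} (hT : T.IsRoundTableOn E)
    {b : ∀ i, D i} {X X' : S} {p p' : N → ℝ} (h : T.Result b X p) (h' : T.Result b X' p') :
    X = X' ∧ p = p' := by
  induction T generalizing E with
  | leaf Y q =>
    obtain ⟨rfl, rfl⟩ := result_leaf_iff.1 h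
    exact (result_leaf_iff.1 h').imp Eq.symm Eq.symm
  | query j m part child ih =>
    obtain ⟨x, hx, h⟩ := result_query_iff.1 h
    obtain ⟨y, hy, h'⟩ := result_query_iff.1 h'
    obtain rfl := hT.eq_of_mem_part hx hy
    exact ih x (hT.isRoundTableOn_child x) h h'

end IsRoundTableOn

/-! ### Neighborhoods -/

open Classical in
/-- The number of proper prefixes of `v`, the root included, at which agent `i` is queried. This is
`numQueries` without the convention of excluding the first node and including the last one. -/
noncomputable def queriesBefore (i : N) : QueryTree N D S → List ℕ → ℕ
  | leaf _ _, _ => 0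
  | query _ _ _ _, [] => 0
  | query j m _ child, x :: v =>
      (if j = i then 1 else 0) + if hx : x < m then queriesBefore i (child ⟨x, hx⟩) v else 0

@[simp]
theorem queriesBefore_nil (i : N) (T : QueryTree N D S) : T.queriesBefore i [] = 0 := by
  cases T <;> rfl

open Classical in
theorem queriesBefore_query_cons (i : N) {j : N} {m : ℕ} {part : Fin m → Set (D j)}
    {child : Fin m → QueryTree N D S} (x : Fin m) (v : List ℕ) :
    (query j m part child).queriesBefore i (x :: v) =
      (if j = i then 1 else 0) + (child x).queriesBefore i v := by
  simp [queriesBefore]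

theorem queriesBefore_query_cons_lt_iff {i j : N} {m : ℕ} {part : Fin m → Set (D j)}
    {child : Fin m → QueryTree N D S} {x : Fin m} {v : List ℕ} {k : ℕ∞} :
    ((query j m part child).queriesBefore i (x :: v) : ℕ∞) < k ↔
      ((child x).queriesBefore i v : ℕ∞) < remaining i j k := by
  rw [queriesBefore_query_cons]
  by_cases hj : j = i
  · simp [hj, lt_tsub_iff_left]
  · simp [hj, remaining_of_ne]

open Classical in
theorem queriesBefore_concat (i : N) (T : QueryTree N D S) (v : List ℕ) (x : ℕ) :
    T.queriesBefore i (v ++ [x]) = T.queriesBefore i v + if T.Queried i v then 1 else 0 := by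
  induction v generalizing T with
  | nil => cases T <;> simp [queriesBefore, not_queried_leaf, queried_query_nil_iff]
  | cons y v ih =>
    cases T with
    | leaf X p => simp [queriesBefore, not_queried_leaf]
    | query j m part child =>
      by_cases hy : y < m
      · lift y to Fin m using hy
        rw [List.cons_append, queriesBefore_query_cons, queriesBefore_query_cons, ih, add_assoc]
        simp only [queried_query_cons_iff]
      · simp [queriesBefore, Queried, sub, hy]

theorem queriesBefore_mono (i : N) (T : QueryTree N D S) {v w : List ℕ} (h : v <+: w) :
    T.queriesBefore i v ≤ T.queriesBefore i w := by
  obtain ⟨r, rfl⟩ := h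
  induction r using List.reverseRecOn with
  | nil => simp
  | append_singleton r x ih =>
    rw [← List.append_assoc, queriesBefore_concat]
    exact ih.trans (Nat.le_add_right _ _)

theorem numQueries_self (T : QueryTree N D S) (i : N) (u : List ℕ) : T.numQueries i u u = 0 := by
  have hempty : {w | u <+: w ∧ u ≠ w ∧ w <+: u ∧ T.Queried i w} = ∅ :=
    Set.eq_empty_of_forall_notMem fun w ⟨huw, hne, hwu, _⟩ =>
      hne (huw.eq_of_length_le hwu.length_le)
  rw [numQueries, hempty, Set.ncard_empty]

open Classical in
theorem numQueries_concat (T : QueryTree N D S) (i : N) {u v : List ℕ} (h : u <+: v) (x : ℕ) :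
    T.numQueries i u (v ++ [x]) =
      T.numQueries i u v + if T.Queried i (v ++ [x]) then 1 else 0 := by
  have hu : u <+: v ++ [x] := h.trans (List.prefix_append v [x])
  have hne : u ≠ v ++ [x] := by
    rintro rfl
    simpa using h.length_le
  have hfin : {w | u <+: w ∧ u ≠ w ∧ w <+: v ∧ T.Queried i w}.Finite :=
    v.inits.toFinset.finite_toSet.subset fun w hw => by simpa using hw.2.2.1
  split_ifs with hq
  · rw [numQueries, numQueries, ← Set.ncard_insert_of_notMem (a := v ++ [x]) _ hfin]
    · congr 1
      ext w
      simp only [Set.mem_insert_iff, Set.mem_ofPred_eq, List.prefix_concat_iff]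
      aesop
    · rintro ⟨-, -, hv, -⟩
      simpa using hv.length_le
  · rw [numQueries, numQueries, add_zero]
    congr 1
    ext w
    simp only [Set.mem_ofPred_eq, List.prefix_concat_iff]
    aesop

open Classical in
theorem numQueries_add_one {T T' : QueryTree N D S} {i : N} {u : List ℕ} (h : T.sub u = some T')
    (hq : T'.Queried i []) (v : List ℕ) :
    T.numQueries i u (u ++ v) + 1 = T'.queriesBefore i v + if T'.Queried i v then 1 else 0 := by
  induction v using List.reverseRecOn with
  | nil => simp [numQueries_self, hq]
  | append_singleton v x ih =>
    rw [← List.append_assoc, numQueries_concat T i (List.prefix_append u v), add_right_comm, ih,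
      queriesBefore_concat, List.append_assoc]
    simp only [queried_append h]

theorem inLimit_append_iff {T T' : QueryTree N D S} {i : N} {u : List ℕ} (h : T.sub u = some T')
    (hq : T'.Queried i []) {k : ℕ∞} {v : List ℕ} :
    T.InLimit i k u (u ++ v) ↔ (T'.Queried i v ∧ (T'.queriesBefore i v : ℕ∞) = k) ∨
      (T'.IsLeaf v ∧ (T'.queriesBefore i v : ℕ∞) < k + 1) := by
  have hn := numQueries_add_one h hq v
  simp only [InLimit, List.prefix_append, true_and, queried_append h, isLeaf_append h]
  refine or_congr (and_congr_right fun hv => ?_) (and_congr_right fun hv => ?_)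
  · rw [if_pos hv, Nat.add_right_cancel_iff] at hn
    rw [hn]
  · rw [if_neg (hv.not_queried i), add_zero] at hn
    rw [← hn, Nat.cast_add, Nat.cast_one, ENat.add_lt_add_iff_right ENat.one_ne_top]

theorem InNeighborhood.exists_queriesBefore_lt {T T' : QueryTree N D S} {i : N} {k : ℕ∞}
    {u v : List ℕ} (hv : T.InNeighborhood i k u v) (h : T.sub u = some T')
    (hq : T'.Queried i []) : ∃ w, v = u ++ w ∧ (T'.queriesBefore i w : ℕ∞) < k + 1 := by
  obtain ⟨_, hl, ⟨w, rfl⟩, ⟨r, rfl⟩⟩ := hv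
  refine ⟨w, rfl, ?_⟩
  have hle : (T'.queriesBefore i w : ℕ∞) ≤ T'.queriesBefore i (w ++ r) :=
    Nat.cast_le.2 (queriesBefore_mono i T' (List.prefix_append w r))
  rw [List.append_assoc, inLimit_append_iff h hq] at hl
  obtain ⟨-, hk⟩ | ⟨-, hk⟩ := hl
  · exact ENat.natCast_lt_add_one_iff.2 (hle.trans hk.le)
  · exact hle.trans_lt hk

theorem exists_inLimit_append {T T' : QueryTree N D S} {i : N} {k : ℕ∞} {u v r : List ℕ}
    (h : T.sub u = some T') (hq : T'.Queried i []) (hk : (T'.queriesBefore i v : ℕ∞) < k + 1)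
    (hl : T'.IsLeaf (v ++ r)) : ∃ w, v <+: w ∧ T.InLimit i k u (u ++ w) := by
  induction r generalizing v with
  | nil => exact ⟨v, List.prefix_rfl, (inLimit_append_iff h hq).2 (.inr ⟨by simpa using hl, hk⟩)⟩
  | cons x r ih =>
    by_cases hv : T'.Queried i v ∧ (T'.queriesBefore i v : ℕ∞) = k
    · exact ⟨v, List.prefix_rfl, (inLimit_append_iff h hq).2 (.inl hv)⟩
    · have hk' : (T'.queriesBefore i (v ++ [x]) : ℕ∞) < k + 1 := by
        rw [queriesBefore_concat]
        split_ifs with hqv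
        · rw [Nat.cast_add, Nat.cast_one, ENat.add_lt_add_iff_right ENat.one_ne_top]
          exact (ENat.natCast_lt_add_one_iff.1 hk).lt_of_ne fun e => hv ⟨hqv, e⟩
        · exact hk
      obtain ⟨w, hw, hlim⟩ := ih hk' (by rwa [List.append_assoc])
      exact ⟨w, (List.prefix_append v [x]).trans hw, hlim⟩

theorem inNeighborhood_append {T T' : QueryTree N D S} {i : N} {k : ℕ∞} {u v r : List ℕ}
    (h : T.sub u = some T') (hq : T'.Queried i []) (hk : (T'.queriesBefore i v : ℕ∞) < k + 1)
    (hl : T'.IsLeaf (v ++ r)) : T.InNeighborhood i k u (u ++ v) := by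
  obtain ⟨w, hvw, hlim⟩ := exists_inLimit_append h hq hk hl
  exact ⟨u ++ w, hlim, List.prefix_append u v, (List.prefix_append_right_inj u).2 hvw⟩

/-- The profiles `a` and `b` are separated at no node of the tree before which agent `i` is queried
fewer than `k` times. For `k + 1` in place of `k` these are the nodes of the `k`-step neighborhood
of the root, if `i` is queried there. -/
def AgreeUpTo (T : QueryTree N D S) (i : N) (k : ℕ∞) (a b : ∀ i, D i) : Prop :=
  ∀ v, (T.queriesBefore i v : ℕ∞) < k → ¬ T.Diverge v a b

theorem mem_equivClass_iff {E : ∀ i, Set (D i)} {T T' : QueryTree N D S}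
    (hT : T.IsRoundTableOn E) {i : N} {u : List ℕ} (h : T.sub u = some T')
    (hq : T'.Queried i []) {k : ℕ∞} {a b : ∀ i, D i} (ha : T.Available a u) :
    b ∈ T.equivClass i k u a ↔ T.Available b u ∧ T'.AgreeUpTo i (k + 1) a b := by
  refine and_congr_right fun hb => ⟨fun ⟨_, hsep⟩ v hv hd => ?_, fun hab => ⟨?_, fun v hv => ?_⟩⟩
  · have hd' := (diverge_append h ha hb).2 hd
    obtain ⟨x, -, -, hax, -⟩ := id hd'
    obtain ⟨r, hr⟩ := hT.exists_isLeaf_append hax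
    rw [List.append_assoc, List.append_assoc, isLeaf_append h] at hr
    exact hsep _ (inNeighborhood_append h hq hv hr) hd'
  · simpa using (diverge_append (v := []) h ha hb).not.2 (hab [] (by simp))
  · obtain ⟨w, rfl, hw⟩ := hv.exists_queriesBefore_lt h hq
    exact (diverge_append h ha hb).not.2 (hab w hw)

theorem agreeUpTo_leaf (X : S) (p : N → ℝ) (i : N) (k : ℕ∞) (a b : ∀ i, D i) :
    (leaf X p : QueryTree N D S).AgreeUpTo i k a b := by
  rintro v - ⟨x, -, -, ha, -⟩
  cases v <;> exact ha

theorem agreeUpTo_query_iff {E : ∀ i, Set (D i)} {j : N} {m : ℕ} {part : Fin m → Set (D j)}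
    {child : Fin m → QueryTree N D S} (hT : IsRoundTableOn E (query j m part child)) {i : N}
    {k : ℕ∞} {a b : ∀ i, D i} (ha : k ≠ 0 → a j ∈ E j) {x : Fin m} (hbx : b j ∈ part x) :
    (query j m part child).AgreeUpTo i k a b ↔
      (k ≠ 0 → a j ∈ part x) ∧ (child x).AgreeUpTo i (remaining i j k) a b := by
  constructor
  · intro hab
    have hax : k ≠ 0 → a j ∈ part x := fun hk => by
      obtain ⟨y, hy⟩ := hT.exists_mem_part (ha hk)
      have hroot := hab [] (by simpa [pos_iff_ne_zero] using hk)
      by_contra hax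
      exact hroot (diverge_query_nil_iff.2 ⟨y, x, fun hyx => hax (hyx ▸ hy), hy, hbx⟩)
    refine ⟨hax, fun v hv hd => hab (x :: v) (queriesBefore_query_cons_lt_iff.2 hv) ?_⟩
    exact diverge_query_cons_iff.2 ⟨hax (remaining_ne_zero hv.ne_bot), hbx, hd⟩
  · rintro ⟨hax, hab⟩ (_ | ⟨y, v⟩) hv hd
    · obtain ⟨y, z, hyz, hy, hz⟩ := diverge_query_nil_iff.1 hd
      have hk : k ≠ 0 := hv.ne_bot
      exact hyz ((hT.eq_of_mem_part hy (hax hk)).trans (hT.eq_of_mem_part hbx hz))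
    · obtain ⟨-, -, -, ⟨hy, -⟩, -⟩ := id hd
      lift y to Fin m using hy
      obtain ⟨-, hby, hd⟩ := diverge_query_cons_iff.1 hd
      obtain rfl := hT.eq_of_mem_part hbx hby
      exact hab v (queriesBefore_query_cons_lt_iff.1 hv) hd

/-! ### Outcomes of a round-table tree -/

/-- The pairs (outcome, payments) that can be reached in the tree when agent `i` answers her first
`k` queries as type `a i` would and all other answers are arbitrary: the counterpart of
`GameTree.outcomes`. The whole profile `a` is a parameter so that the type of the queried agent `j`
can be compared with `part x` without a cast along `j = i`. -/
def outcomes (i : N) (a : ∀ i, D i) : ℕ∞ → QueryTree N D S → Set (S × (N → ℝ))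
  | _, leaf X p => {(X, p)}
  | k, query j _ part child =>
      {o | ∃ x, (j = i → k ≠ 0 → a j ∈ part x) ∧ o ∈ outcomes i a (remaining i j k) (child x)}

theorem outcomes_anti (i : N) (a : ∀ i, D i) (T : QueryTree N D S) :
    Antitone fun k => outcomes i a k T := by
  intro k l hkl o ho
  induction T generalizing k l with
  | leaf X p => exact ho
  | query j m part child ih =>
    obtain ⟨x, hx, ho⟩ := ho
    refine ⟨x, fun hj hk => hx hj ?_, ih x (remaining_mono i j hkl) ho⟩
    rintro rfl
    exact hk (le_zero_iff.1 hkl)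

theorem Result.mem_outcomes {E : ∀ i, Set (D i)} {T : QueryTree N D S} (hT : T.IsRoundTableOn E)
    {i : N} {k : ℕ∞} {a b : ∀ i, D i} (ha : k ≠ 0 → a ∈ Set.univ.pi E)
    (hab : T.AgreeUpTo i k a b) {X : S} {p : N → ℝ} (hb : T.Result b X p) :
    (X, p) ∈ T.outcomes i a k := by
  classical
  induction T generalizing E k with
  | leaf Y q =>
    obtain ⟨rfl, rfl⟩ := result_leaf_iff.1 hb
    rfl
  | query j m part child ih =>
    obtain ⟨x, hx, hb⟩ := result_query_iff.1 hb
    obtain ⟨hax, hab⟩ := (agreeUpTo_query_iff hT (fun hk => ha hk j trivial) hx).1 hab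
    refine ⟨x, fun _ => hax, ih x (hT.isRoundTableOn_child x) (fun hk => ?_) hab hb⟩
    have hk := remaining_ne_zero hk
    exact (mem_pi_update_iff (hT.part_subset x)).2 ⟨ha hk, hax hk⟩

open Classical in
theorem exists_result_of_mem_outcomes {E : ∀ i, Set (D i)} {T : QueryTree N D S}
    (hT : T.IsRoundTableOn E) (hE : (Set.univ.pi E).Nonempty) {i : N} {k : ℕ∞} {a : ∀ i, D i}
    {o : S × (N → ℝ)} (ha : k ≠ 0 → a i ∈ E i) (ho : o ∈ T.outcomes i a k) :
    ∃ b ∈ Set.univ.pi E, T.Result b o.1 o.2 ∧ T.AgreeUpTo i k (Function.update b i (a i)) b := by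
  induction T generalizing E k with
  | leaf X p =>
    obtain ⟨b, hb⟩ := hE
    cases ho
    exact ⟨b, hb, result_leaf_iff.2 ⟨rfl, rfl⟩, agreeUpTo_leaf X p i k _ b⟩
  | query j m part child ih =>
    obtain ⟨x, hx, ho⟩ := ho
    obtain ⟨b, hb, hr, hab⟩ := ih x (hT.isRoundTableOn_child x)
      (nonempty_pi_update hE (hT.part_nonempty x)) (mem_update_of_remaining_ne_zero ha hx) ho
    obtain ⟨hbE, hbx⟩ := (mem_pi_update_iff (hT.part_subset x)).1 hb
    refine ⟨b, hbE, result_query_iff.2 ⟨x, hbx, hr⟩, ?_⟩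
    by_cases hj : j = i
    · subst hj
      exact (agreeUpTo_query_iff hT (by simpa using ha) hbx).2 ⟨by simpa using hx rfl, hab⟩
    · have hupd : Function.update b i (a i) j = b j := Function.update_of_ne hj _ _
      exact (agreeUpTo_query_iff hT (fun _ => hupd ▸ hbE j trivial) hbx).2
        ⟨fun _ => hupd ▸ hbx, hab⟩

theorem kStepOSP_iff {T : QueryTree N D S} (hT : T.IsRoundTable) {cost : ∀ i, D i → S → ℝ}
    {k : ℕ∞} : T.KStepOSP cost k ↔
      ∀ i u m part child, T.sub u = some (query i m part child) →
        ∀ a c, T.Diverge u a c → ∀ o ∈ (query i m part child).outcomes i a (k + 1),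
          ∀ X' p', T.Result c X' p' →
            p' i - cost i (a i) X' ≤ o.2 i - cost i (a i) o.1 := by
  classical
  constructor
  · intro hosp i u m part child hu a c hac o ho X' p' hc
    obtain ⟨ha, hcu, hac⟩ := (diverge_iff_of_sub hu).1 hac
    obtain ⟨E, hE, hmem⟩ := hT.exists_domains hu
    have haE : a ∈ Set.univ.pi E := (hmem a).2 ⟨fun _ _ => trivial, ha⟩
    obtain ⟨b, hb, hbr, hab⟩ :=
      exists_result_of_mem_outcomes hE ⟨a, haE⟩ (fun _ => haE i trivial) ho
    let a' := Function.update b i (a i)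
    have hai : a' i = a i := Function.update_self ..
    have ha' : T.Available a' u :=
      ((hmem a').1 (Set.update_mem_pi_iff_of_mem hb |>.2 fun _ => haE i trivial)).2
    have hbu : T.Available b u := ((hmem b).1 hb).2
    have hac' : T.Diverge u a' c := by
      rw [diverge_iff_of_sub hu, diverge_query_nil_iff, hai, ← diverge_query_nil_iff]
      exact ⟨ha', hcu, hac⟩
    have hba' : b ∈ T.equivClass i k u a' :=
      (mem_equivClass_iff hT hu ⟨m, part, child, rfl⟩ ha').2 ⟨hbu, hab⟩
    simpa [hai] using
      hosp i u ⟨m, part, child, hu⟩ a' b c ha' hba' hac' _ _ X' p'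
        ((hT.result_iff_of_sub hu hbu).2 hbr) hc
  · rintro hosp i u ⟨m, part, child, hu⟩ a b c ha hb hac X p X' p' hbr hcr
    obtain ⟨E, hE, hmem⟩ := hT.exists_domains hu
    obtain ⟨hbu, hab⟩ := (mem_equivClass_iff hT hu ⟨m, part, child, rfl⟩ ha).1 hb
    have hbr : (query i m part child).Result b X p := (hT.result_iff_of_sub hu hbu).1 hbr
    exact hosp i u m part child hu a c hac (X, p)
      (hbr.mem_outcomes hE (fun _ => (hmem a).2 ⟨fun _ _ => trivial, ha⟩) hab) X' p' hcr

/-! ### From round-table trees to extensive-form mechanisms -/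

/-- The game of perfect information in which the queried agent announces the index of the subdomain
that contains her type. The information set of a node is the code of the node itself, so the
position `p` of the tree in the whole game is carried along. -/
def toGame : List ℕ → QueryTree N D S → GameTree N S
  | _, leaf X q => .terminal X q
  | p, query i m _ child =>
      .decision i (Encodable.encode p) m fun x => (child x).toGame (p ++ [(x : ℕ)])

theorem sub_toGame (T : QueryTree N D S) (p u : List ℕ) :
    (T.toGame p).sub u = (T.sub u).map (toGame (p ++ u)) := by
  induction u generalizing T p with
  | nil => cases T <;> simp [toGame, GameTree.sub]
  | cons x u ih =>
    cases T with
    | leaf X q => simp [toGame, GameTree.sub, sub]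
    | query i m part child =>
      by_cases hx : x < m
      · simp [toGame, GameTree.sub, sub, hx, ih]
      · simp [toGame, GameTree.sub, sub, hx]

theorem sub_toGame_eq_decision_iff {T : QueryTree N D S} {p u : List ℕ} {i : N} {I m : ℕ}
    {next : Fin m → GameTree N S} :
    (T.toGame p).sub u = some (.decision i I m next) ↔ I = Encodable.encode (p ++ u) ∧
      ∃ part child, T.sub u = some (query i m part child) ∧
        next = fun x => (child x).toGame (p ++ u ++ [(x : ℕ)]) := by
  rw [sub_toGame, Option.map_eq_some_iff]
  constructor
  · rintro ⟨_ | ⟨j, m', part, child⟩, hs, h⟩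
    · simp [toGame] at h
    · cases h
      exact ⟨rfl, part, child, hs, rfl⟩
  · rintro ⟨rfl, part, child, hs, rfl⟩
    exact ⟨_, hs, rfl⟩

theorem sub_toGame_ne_chance (T : QueryTree N D S) (p u : List ℕ) {m : ℕ} (w : Fin m → ℝ)
    (next : Fin m → GameTree N S) : (T.toGame p).sub u ≠ some (.chance m w next) := by
  rw [sub_toGame]
  intro h
  obtain ⟨_ | _, -, h⟩ := Option.map_eq_some_iff.1 h <;> simp [toGame] at h

/-- In the game of the tree `T` at position `p`, the strategy `σ` of agent `i` always announces the
subdomain that contains `t`, if there is one. -/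
def IsTruthful (T : QueryTree N D S) (i : N) (t : D i) (p : List ℕ) (σ : ℕ → ℕ) : Prop :=
  ∀ u m part child, T.sub u = some (query i m part child) → ∀ x, t ∈ part x →
    σ (Encodable.encode (p ++ u)) = x

theorem IsTruthful.of_query {j i : N} {m : ℕ} {part : Fin m → Set (D j)}
    {child : Fin m → QueryTree N D S} {t : D i} {p : List ℕ} {σ : ℕ → ℕ}
    (hσ : (query j m part child).IsTruthful i t p σ) (x : Fin m) :
    (child x).IsTruthful i t (p ++ [(x : ℕ)]) σ := by
  intro u m' part' child' hs y hy
  rw [List.append_assoc]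
  exact hσ (x :: u) m' part' child' ((sub_query_cons x u).trans hs) y hy

theorem IsTruthful.of_sub {T T' : QueryTree N D S} {i : N} {t : D i} {p u : List ℕ} {σ : ℕ → ℕ}
    (hσ : T.IsTruthful i t p σ) (h : T.sub u = some T') : T'.IsTruthful i t (p ++ u) σ := by
  intro v m part child hs x hx
  rw [List.append_assoc]
  exact hσ (u ++ v) m part child ((sub_append h v).trans hs) x hx

theorem IsTruthful.apply_root {i : N} {m : ℕ} {part : Fin m → Set (D i)}
    {child : Fin m → QueryTree N D S} {t : D i} {p : List ℕ} {σ : ℕ → ℕ}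
    (hσ : (query i m part child).IsTruthful i t p σ) {x : Fin m} (hx : t ∈ part x) :
    σ (Encodable.encode p) = x := by
  simpa using hσ [] m part child rfl x hx

theorem IsTruthful.exists_available {E : ∀ i, Set (D i)} {T T' : QueryTree N D S}
    (hT : T.IsRoundTableOn E) (hE : (Set.univ.pi E).Nonempty) {i : N} {t : D i} (ht : t ∈ E i)
    {p u : List ℕ} {σ : ℕ → ℕ} (hσ : T.IsTruthful i t p σ) (h : T.sub u = some T')
    (hf : (T.toGame p).Follows i σ u) :
    ∃ a ∈ Set.univ.pi E, a i = t ∧ T.Available a u := by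
  classical
  induction h using sub_induction generalizing E p with
  | nil =>
    obtain ⟨a, ha⟩ := hE
    exact ⟨Function.update a i t, Set.update_mem_pi_iff_of_mem ha |>.2 fun _ => ht,
      Function.update_self .., available_nil _ _⟩
  | @cons j m part child x u _ ih =>
    obtain ⟨hx, hf⟩ := GameTree.follows_decision_cons_iff.1 hf
    have ht' : t ∈ Function.update E j (part x) i := by
      by_cases hj : j = i
      · subst hj
        obtain ⟨y, hy⟩ := hT.exists_mem_part ht
        obtain rfl : x = y := Fin.ext ((hx rfl).trans (hσ.apply_root hy))
        simpa using hy
      · rwa [Function.update_of_ne (Ne.symm hj)]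
    obtain ⟨a, ha, hai, hau⟩ := ih (hT.isRoundTableOn_child x)
      (nonempty_pi_update hE (hT.part_nonempty x)) ht' (hσ.of_query x) hf
    obtain ⟨haE, hax⟩ := (mem_pi_update_iff (hT.part_subset x)).1 ha
    exact ⟨a, haE, hai, available_query_cons.2 ⟨hax, hau⟩⟩

theorem IsTruthful.outcomes_toGame_subset {E : ∀ i, Set (D i)} {T : QueryTree N D S}
    (hT : T.IsRoundTableOn E) {i : N} {a : ∀ i, D i} {p : List ℕ} {σ : ℕ → ℕ}
    (hσ : T.IsTruthful i (a i) p σ) {k : ℕ∞} (ha : k ≠ 0 → a i ∈ E i) :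
    GameTree.outcomes i σ k (T.toGame p) ⊆ T.outcomes i a k := by
  classical
  intro o ho
  induction T generalizing E p k with
  | leaf X q => exact ho
  | query j m part child ih =>
    obtain ⟨x, hx, ho⟩ := GameTree.mem_outcomes_decision.1 ho
    have hax : j = i → k ≠ 0 → a j ∈ part x := by
      rintro rfl hk
      obtain ⟨y, hy⟩ := hT.exists_mem_part (ha hk)
      obtain rfl : x = y := Fin.ext ((hx rfl hk).trans (hσ.apply_root hy))
      exact hy
    exact ⟨x, hax, ih x (hT.isRoundTableOn_child x) (hσ.of_query x)
      (mem_update_of_remaining_ne_zero ha hax) ho⟩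

theorem result_of_mem_plays_toGame {E : ∀ i, Set (D i)} {T : QueryTree N D S}
    (hT : T.IsRoundTableOn E) {b : ∀ i, D i} (hb : b ∈ Set.univ.pi E) {p : List ℕ}
    {σ : N → ℕ → ℕ} (hσ : ∀ i, T.IsTruthful i (b i) p (σ i)) {o : S × (N → ℝ)}
    (ho : o ∈ GameTree.plays σ (T.toGame p)) : T.Result b o.1 o.2 := by
  classical
  induction T generalizing E p with
  | leaf X q =>
    cases ho
    exact result_leaf_iff.2 ⟨rfl, rfl⟩
  | query j m part child ih =>
    obtain ⟨x, hx, ho⟩ := ho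
    obtain ⟨y, hy⟩ := hT.exists_mem_part (hb j trivial)
    obtain rfl : x = y := Fin.ext (hx.trans ((hσ j).apply_root hy))
    exact result_query_iff.2 ⟨x, hy, ih x (hT.isRoundTableOn_child x)
      ((mem_pi_update_iff (hT.part_subset x)).2 ⟨hb, hy⟩) (fun i => (hσ i).of_query x) ho⟩

/-- The truthful strategy of type `t` of agent `i` in the game of the tree `T`. The set has at most
one element; if it is empty, because `t` is not available at the node coded by `I`, the action is
`sInf ∅ = 0`, which is always an available one. -/
noncomputable def truthful (T : QueryTree N D S) (i : N) (t : D i) (I : ℕ) : ℕ :=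
  sInf {y | ∃ u m part child, ∃ x : Fin m, Encodable.encode u = I ∧
    T.sub u = some (query i m part child) ∧ t ∈ part x ∧ x = y}

theorem truthful_encode {T : QueryTree N D S} {i : N} {t : D i} {u : List ℕ} {m : ℕ}
    {part : Fin m → Set (D i)} {child : Fin m → QueryTree N D S}
    (h : T.sub u = some (query i m part child)) :
    T.truthful i t (Encodable.encode u) = sInf (Fin.val '' {x | t ∈ part x}) := by
  refine congrArg sInf (Set.ext fun y => ⟨?_, ?_⟩)
  · rintro ⟨u', m', part', child', x, hu, hs, hx, rfl⟩
    obtain rfl : u' = u := Encodable.encode_injective hu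
    cases h.symm.trans hs
    exact ⟨x, hx, rfl⟩
  · rintro ⟨x, hx, rfl⟩
    exact ⟨u, m, part, child, x, rfl, h, hx, rfl⟩

theorem isTruthful_truthful {E : ∀ i, Set (D i)} {T : QueryTree N D S} (hT : T.IsRoundTableOn E)
    (i : N) (t : D i) : T.IsTruthful i t [] (T.truthful i t) := by
  intro u m part child hs x hx
  obtain ⟨E', hT', -⟩ := hT.exists_domains hs
  have hsingleton : {y | t ∈ part y} = {x} :=
    Set.eq_singleton_iff_unique_mem.2 ⟨hx, fun y hy => hT'.eq_of_mem_part hy hx⟩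
  rw [List.nil_append, truthful_encode hs, hsingleton, Set.image_singleton, csInf_singleton]

theorem truthful_lt {T : QueryTree N D S} {i : N} {t : D i} {u : List ℕ} {m : ℕ}
    {part : Fin m → Set (D i)} {child : Fin m → QueryTree N D S}
    (h : T.sub u = some (query i m part child)) (hm : 0 < m) :
    T.truthful i t (Encodable.encode u) < m := by
  rw [truthful_encode h]
  rcases (Fin.val '' {x | t ∈ part x}).eq_empty_or_nonempty with hempty | hne
  · rwa [hempty, Nat.sInf_empty]
  · obtain ⟨x, -, hx⟩ := Nat.sInf_mem hne
    exact hx ▸ x.2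

theorem IsRoundTableOn.pos_of_sub {E : ∀ i, Set (D i)} {T : QueryTree N D S}
    (hT : T.IsRoundTableOn E) {u : List ℕ} {i : N} {m : ℕ} {part : Fin m → Set (D i)}
    {child : Fin m → QueryTree N D S} (h : T.sub u = some (query i m part child)) : 0 < m := by
  obtain ⟨E', hT', -⟩ := hT.exists_domains h
  exact zero_lt_two.trans_le hT'.two_le

theorem IsRoundTableOn.isGame_toGame {E : ∀ i, Set (D i)} {T : QueryTree N D S}
    (hT : T.IsRoundTableOn E) : (T.toGame []).IsGame where
  action_exists h i I m next hs := by
    obtain ⟨-, part, child, hu, -⟩ := sub_toGame_eq_decision_iff.1 hs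
    exact hT.pos_of_sub hu
  prob_pos h m w next hs := (sub_toGame_ne_chance T [] h w next hs).elim
  prob_sum h m w next hs := (sub_toGame_ne_chance T [] h w next hs).elim
  same_actions h h' i I m m' next next' hs hs' := by
    obtain ⟨rfl, -⟩ := sub_toGame_eq_decision_iff.1 hs
    obtain ⟨he, -⟩ := sub_toGame_eq_decision_iff.1 hs'
    obtain rfl : h = h' := by simpa using he
    cases hs.symm.trans hs'
    rfl
  perfect_recall := by
    rintro i I h h' ⟨m, next, hs⟩ ⟨m', next', hs'⟩
    obtain ⟨rfl, -⟩ := sub_toGame_eq_decision_iff.1 hs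
    obtain ⟨he, -⟩ := sub_toGame_eq_decision_iff.1 hs'
    obtain rfl : h = h' := by simpa using he
    rfl

/-- The mechanism given by a round-table tree and truthful answers. -/
noncomputable def toMechanism (T : QueryTree N D S) (hT : T.IsRoundTable) : Mechanism N D S where
  game := T.toGame []
  isGame := hT.isGame_toGame
  strategy := T.truthful
  isStrategy i t u I m next hs := by
    obtain ⟨rfl, part, child, hu, -⟩ := sub_toGame_eq_decision_iff.1 hs
    exact truthful_lt hu (hT.pos_of_sub hu)

theorem Implements.toMechanism {T : QueryTree N D S} {f : (∀ i, D i) → S} (hf : T.Implements f)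
    (hT : T.IsRoundTable) : (T.toMechanism hT).Implements f := by
  intro t o ho
  obtain ⟨p, hp⟩ := hf t
  exact (hT.result_unique (result_of_mem_plays_toGame hT (fun _ _ => trivial)
    (fun i => isTruthful_truthful hT i (t i)) ho) hp).1

theorem mem_outcomesFrom_toGame_iff {T : QueryTree N D S} {i : N} {σ : ℕ → ℕ} {k : ℕ∞}
    {u : List ℕ} {m : ℕ} {part : Fin m → Set (D i)} {child : Fin m → QueryTree N D S}
    (h : T.sub u = some (query i m part child)) {o : S × (N → ℝ)} :
    o ∈ (T.toGame []).outcomesFrom i σ k (Encodable.encode u) ↔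
      o ∈ GameTree.outcomes i σ (k + 1) ((query i m part child).toGame u) := by
  rw [GameTree.mem_outcomesFrom_iff]
  constructor
  · rintro ⟨u', m', next, hs, ho⟩
    obtain ⟨he, part', child', hu, rfl⟩ := sub_toGame_eq_decision_iff.1 hs
    obtain rfl : u = u' := Encodable.encode_injective he
    cases h.symm.trans hu
    exact ho
  · exact fun ho => ⟨u, m, _, sub_toGame_eq_decision_iff.2 ⟨rfl, part, child, h, rfl⟩, ho⟩

theorem exists_result_of_mem_outcomes_toGame {T : QueryTree N D S} (hT : T.IsRoundTable)
    {i : N} {a : ∀ i, D i} {k : ℕ∞} {u : List ℕ} {m : ℕ} {part : Fin m → Set (D i)}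
    {child : Fin m → QueryTree N D S} (hu : T.sub u = some (query i m part child))
    (hau : T.Available a u) (y : Fin m) {σ : ℕ → ℕ} {o : S × (N → ℝ)}
    (ho : o ∈ GameTree.outcomes i σ k ((child y).toGame (u ++ [(y : ℕ)]))) :
    ∃ c, T.Available c u ∧ c i ∈ part y ∧ T.Result c o.1 o.2 := by
  classical
  obtain ⟨E, hE, hmem⟩ := hT.exists_domains hu
  have haE : a ∈ Set.univ.pi E := (hmem a).2 ⟨fun _ _ => trivial, hau⟩
  have hσ := ((isTruthful_truthful hT i (a i)).of_sub hu).of_query y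
  have ho : o ∈ (child y).outcomes i a 0 :=
    hσ.outcomes_toGame_subset (hE.isRoundTableOn_child y) (fun h => absurd rfl h)
      (GameTree.outcomes_subset_zero i σ _ k _ ho)
  obtain ⟨c, hc, hr, -⟩ := exists_result_of_mem_outcomes (hE.isRoundTableOn_child y)
    (nonempty_pi_update ⟨a, haE⟩ (hE.part_nonempty y)) (fun h => absurd rfl h) ho
  obtain ⟨hcE, hcy⟩ := (mem_pi_update_iff (hE.part_subset y)).1 hc
  have hcu := ((hmem c).1 hcE).2
  exact ⟨c, hcu, hcy, (hT.result_iff_of_sub hu hcu).2 (result_query_iff.2 ⟨y, hcy, hr⟩)⟩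

theorem KStepOSP.toMechanism {T : QueryTree N D S} {cost : ∀ i, D i → S → ℝ} {k : ℕ∞}
    (hk : T.KStepOSP cost k) (hT : T.IsRoundTable) [Nonempty (∀ i, D i)] :
    (T.toMechanism hT).KStepOSP cost k := by
  rintro i t σ' - I ⟨⟨u, ⟨m, next, hs⟩, hf⟩, -, -, hne⟩ o ho o' ho'
  obtain ⟨rfl, part, child, hu, rfl⟩ := sub_toGame_eq_decision_iff.1 hs
  have hσ := isTruthful_truthful hT i t
  obtain ⟨a, -, rfl, hau⟩ :=
    hσ.exists_available hT ⟨Classical.arbitrary _, fun _ _ => trivial⟩ trivial hu hf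
  obtain ⟨E, hE, hmem⟩ := hT.exists_domains hu
  have haE : a i ∈ E i := (hmem a).2 ⟨fun _ _ => trivial, hau⟩ i trivial
  have ho : o ∈ (query i m part child).outcomes i a (k + 1) :=
    (hσ.of_sub hu).outcomes_toGame_subset hE (fun _ => haE)
      ((mem_outcomesFrom_toGame_iff hu).1 ho)
  obtain ⟨y, hy, ho'⟩ := GameTree.mem_outcomes_decision.1 ((mem_outcomesFrom_toGame_iff hu).1 ho')
  obtain ⟨c, hcu, hcy, hc⟩ := exists_result_of_mem_outcomes_toGame hT hu hau y ho'
  obtain ⟨x, hx⟩ := hE.exists_mem_part haE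
  have hxy : x ≠ y := by
    rintro rfl
    exact hne (((hσ.of_sub hu).apply_root hx).trans (hy rfl (by simp)))
  have hac : T.Diverge u a c :=
    (diverge_iff_of_sub hu).2 ⟨hau, hcu, diverge_query_nil_iff.2 ⟨x, y, hxy, hx, hcy⟩⟩
  exact (kStepOSP_iff hT).1 hk i u m part child hu a c hac o ho _ _ hc

theorem kStepOSP_toMechanism_leaf (X : S) (p : N → ℝ) (cost : ∀ i, D i → S → ℝ) (k : ℕ∞) :
    ((leaf X p : QueryTree N D S).toMechanism trivial).KStepOSP cost k := by
  rintro i t σ' - I ⟨⟨h, ⟨m, next, hs⟩, -⟩, -⟩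
  obtain ⟨-, part, child, hu, -⟩ := sub_toGame_eq_decision_iff.1 hs
  exact (not_queried_leaf i X p h ⟨m, part, child, hu⟩).elim

end QueryTree

/-! ### From mechanisms to round-table trees -/

open Classical in
/-- `Simulates s E G T`: the tree `T` asks, for current domains `E`, which actions the strategies
`s i t` take in the game `G`. Chance nodes are replaced by one of their branches, and decision nodes
at which all types in the current domain take the same action are skipped. -/
inductive Simulates (s : ∀ i, D i → ℕ → ℕ) :
    (∀ i, Set (D i)) → GameTree N S → QueryTree N D S → Prop where
  | terminal (E : ∀ i, Set (D i)) (X : S) (p : N → ℝ) : Simulates s E (.terminal X p) (.leaf X p)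
  | chance {E : ∀ i, Set (D i)} {m : ℕ} (w : Fin m → ℝ) {next : Fin m → GameTree N S} (x : Fin m)
      {T : QueryTree N D S} (h : Simulates s E (next x) T) : Simulates s E (.chance m w next) T
  | skip {E : ∀ i, Set (D i)} {i : N} {I m : ℕ} {next : Fin m → GameTree N S} {x : Fin m}
      {T : QueryTree N D S} (hx : ∀ t ∈ E i, s i t I = x) (h : Simulates s E (next x) T) :
      Simulates s E (.decision i I m next) T
  | ask {E : ∀ i, Set (D i)} {i : N} {I m n : ℕ} {next : Fin m → GameTree N S} {act : Fin n → Fin m}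
      {child : Fin n → QueryTree N D S} (hact : Function.Injective act)
      (h : ∀ x, Simulates s (Function.update E i {t ∈ E i | s i t I = act x}) (next (act x))
        (child x)) :
      Simulates s E (.decision i I m next)
        (.query i n (fun x => {t ∈ E i | s i t I = act x}) child)

open Classical in
theorem QueryTree.isRoundTableOn_query_fibers {E : ∀ i, Set (D i)} {i : N} {α : Type*} {g : D i → α}
    {n : ℕ} {act : Fin n → α} {child : Fin n → QueryTree N D S} (hn : 2 ≤ n)
    (hinj : Function.Injective act) (himage : Set.range act = g '' E i)
    (hchild : ∀ x, IsRoundTableOn (Function.update E i {t ∈ E i | g t = act x}) (child x)) :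
    IsRoundTableOn E (.query i n (fun x => {t ∈ E i | g t = act x}) child) := by
  refine ⟨hn, fun x => ?_, fun x y hxy => ?_, ?_, hchild⟩
  · exact himage.subset ⟨x, rfl⟩
  · exact Set.disjoint_left.2 fun t ht ht' => hxy (hinj (ht.2.symm.trans ht'.2))
  · refine (Set.iUnion_subset fun x => Set.sep_subset _ _).antisymm fun t ht => ?_
    obtain ⟨x, hx⟩ := himage.superset ⟨t, ht, rfl⟩
    exact Set.mem_iUnion.2 ⟨x, ht, hx.symm⟩

theorem constant_on_or_exists_fin_param {α β : Type*} [Finite β] [Nonempty β] (g : α → β)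
    (A : Set α) :
    (∃ y, ∀ t ∈ A, g t = y) ∨
      ∃ n, ∃ act : Fin n → β, 2 ≤ n ∧ Function.Injective act ∧ Set.range act = g '' A := by
  obtain ⟨n, act, hact, himage⟩ := (Set.toFinite (g '' A)).fin_param
  rcases le_or_gt 2 n with hn | hn
  · exact .inr ⟨n, act, hn, hact, himage⟩
  have : Subsingleton (Fin n) := Fin.subsingleton_iff_le_one.2 (Nat.lt_succ_iff.1 hn)
  have hA : (g '' A).Subsingleton := himage ▸ Set.subsingleton_range act
  rcases A.eq_empty_or_nonempty with rfl | ⟨t, ht⟩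
  · exact .inl ⟨Classical.arbitrary β, fun _ h => h.elim⟩
  · exact .inl ⟨g t, fun t' ht' => hA ⟨t', ht', rfl⟩ ⟨t, ht, rfl⟩⟩

theorem exists_simulates (s : ∀ i, D i → ℕ → ℕ) {G : GameTree N S}
    (hdecision : ∀ h i I m next, G.sub h = some (.decision i I m next) → 0 < m)
    (hstrategy : ∀ i t, G.IsStrategy i (s i t))
    (hchance : ∀ h m w next, G.sub h = some (.chance m w next) → 0 < m) (E : ∀ i, Set (D i)) :
    ∃ T, Simulates s E G T ∧ T.IsRoundTableOn E := by
  classical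
  induction G generalizing E with
  | terminal X p => exact ⟨_, .terminal E X p, trivial⟩
  | chance m w next ih =>
    have hsub := GameTree.sub_chance_cons w next
    obtain ⟨T, hsim, hT⟩ := ih ⟨0, hchance [] m w next rfl⟩
      (fun h i I m' next' hs => hdecision _ i I m' next' ((hsub _ h).trans hs))
      (fun i t h I m' next' hs => hstrategy i t _ I m' next' ((hsub _ h).trans hs))
      (fun h m' w' next' hs => hchance _ m' w' next' ((hsub _ h).trans hs)) E
    exact ⟨T, .chance w _ hsim, hT⟩
  | decision i I m next ih =>
    have hsub := GameTree.sub_decision_cons i I next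
    have ih' (x : Fin m) := ih x
      (fun h i I m' next' hs => hdecision _ i I m' next' ((hsub x h).trans hs))
      (fun i t h I m' next' hs => hstrategy i t _ I m' next' ((hsub x h).trans hs))
      (fun h m' w' next' hs => hchance _ m' w' next' ((hsub x h).trans hs))
    let action (t : D i) : Fin m := ⟨s i t I, hstrategy i t [] I m next rfl⟩
    have : Nonempty (Fin m) := ⟨⟨0, hdecision [] i I m next rfl⟩⟩
    rcases constant_on_or_exists_fin_param action (E i) with ⟨x, hx⟩ | ⟨n, act, hn, hact, himage⟩
    · obtain ⟨T, hsim, hT⟩ := ih' x E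
      exact ⟨T, .skip (fun t ht => congrArg Fin.val (hx t ht)) hsim, hT⟩
    · choose child hsim hT using fun x =>
        ih' (act x) (Function.update E i {t ∈ E i | s i t I = act x})
      refine ⟨_, .ask hact hsim, QueryTree.isRoundTableOn_query_fibers hn
        (g := fun t => s i t I) (Fin.val_injective.comp hact) ?_ hT⟩
      exact (Set.range_comp Fin.val act).trans (himage ▸ Set.image_image ..)

namespace Simulates

variable {s : ∀ i, D i → ℕ → ℕ} {E : ∀ i, Set (D i)} {G : GameTree N S} {T : QueryTree N D S}

theorem mem_plays (h : Simulates s E G T) {b : ∀ i, D i} (hb : b ∈ Set.univ.pi E) {X : S}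
    {p : N → ℝ} (hr : T.Result b X p) : (X, p) ∈ GameTree.plays (fun i => s i (b i)) G := by
  classical
  induction h with
  | terminal E Y q =>
    obtain ⟨rfl, rfl⟩ := QueryTree.result_leaf_iff.1 hr
    rfl
  | chance _ x _ ih => exact ⟨x, ih hb hr⟩
  | skip hx _ ih => exact ⟨_, (hx _ (hb _ trivial)).symm, ih hb hr⟩
  | ask _ _ ih =>
    obtain ⟨x, hx, hr⟩ := QueryTree.result_query_iff.1 hr
    exact ⟨_, hx.2.symm, ih x ((mem_pi_update_iff (Set.sep_subset _ _)).2 ⟨hb, hx⟩) hr⟩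

theorem outcomes_subset (h : Simulates s E G T) {i : N} {a : ∀ i, D i} {k : ℕ∞}
    (ha : k ≠ 0 → a i ∈ E i) :
    T.outcomes i a k ⊆ GameTree.outcomes i (s i (a i)) k G := by
  classical
  induction h generalizing k with
  | terminal E X p => exact subset_rfl
  | chance _ x _ ih => exact fun o ho => ⟨x, ih ha ho⟩
  | @skip E j I m next x T hx _ ih =>
    refine fun o ho => ⟨x, ?_, ih (fun hk => ha (remaining_ne_zero hk)) ?_⟩
    · rintro rfl hk
      exact (hx _ (ha hk)).symm
    · exact QueryTree.outcomes_anti i a T (remaining_le i j k) ho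
  | @ask E j I m n next act child _ _ ih =>
    rintro o ⟨x, hx, ho⟩
    refine ⟨act x, ?_, ih x (mem_update_of_remaining_ne_zero ha hx) ho⟩
    rintro rfl hk
    exact (hx rfl hk).2.symm

theorem exists_history (h : Simulates s E G T) {u : List ℕ} {i : N} {n : ℕ}
    {part : Fin n → Set (D i)} {child : Fin n → QueryTree N D S}
    (hu : T.sub u = some (.query i n part child)) :
    ∃ g I m next E', G.sub g = some (.decision i I m next) ∧
      Simulates s E' (.decision i I m next) (.query i n part child) ∧
      (∀ x y, x ≠ y → ∀ t ∈ part x, ∀ t' ∈ part y, s i t I ≠ s i t' I) ∧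
      ∀ b ∈ Set.univ.pi E, T.Available b u →
        b ∈ Set.univ.pi E' ∧ ∀ j, G.Follows j (s j (b j)) g := by
  classical
  induction h generalizing u with
  | terminal E X p => cases u <;> simp [QueryTree.sub] at hu
  | chance w x _ ih =>
    obtain ⟨g, I, m, next, E', hg, hsim, hsep, hfollow⟩ := ih hu
    exact ⟨x :: g, I, m, next, E', (GameTree.sub_chance_cons _ _ x g).trans hg, hsim, hsep,
      fun b hb hbu => (hfollow b hb hbu).imp_right fun hf j =>
        GameTree.follows_chance_cons_iff.2 (hf j)⟩
  | @skip E j J m next x T hx _ ih =>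
    obtain ⟨g, I, m', next', E', hg, hsim, hsep, hfollow⟩ := ih hu
    refine ⟨x :: g, I, m', next', E', (GameTree.sub_decision_cons j J next x g).trans hg, hsim,
      hsep, fun b hb hbu => (hfollow b hb hbu).imp_right fun hf l =>
        GameTree.follows_decision_cons_iff.2 ⟨?_, hf l⟩⟩
    rintro rfl
    exact (hx _ (hb j trivial)).symm
  | @ask E j J m n' next act child' hact hchild ih =>
    rcases u with _ | ⟨x, u⟩
    · cases hu
      refine ⟨[], J, m, next, E, rfl, .ask hact hchild, fun x y hxy t ht t' ht' heq => hxy ?_,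
        fun b hb _ => ⟨hb, fun l => GameTree.follows_nil _ l _⟩⟩
      exact hact (Fin.ext (ht.2.symm.trans (heq.trans ht'.2)))
    · by_cases hx : x < n'
      · lift x to Fin n' using hx
        rw [QueryTree.sub_query_cons] at hu
        obtain ⟨g, I, m', next', E', hg, hsim, hsep, hfollow⟩ := ih x hu
        refine ⟨act x :: g, I, m', next', E',
          (GameTree.sub_decision_cons j J next (act x) g).trans hg, hsim, hsep, fun b hb hbu => ?_⟩
        obtain ⟨hbx, hbu⟩ := QueryTree.available_query_cons.1 hbu
        refine (hfollow b ((mem_pi_update_iff (Set.sep_subset _ _)).2 ⟨hb, hbx⟩) hbu).imp_right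
          fun hf l => GameTree.follows_decision_cons_iff.2 ⟨?_, hf l⟩
        rintro rfl
        exact hbx.2.symm
      · simp [QueryTree.sub, hx] at hu

theorem kStepOSP {M : Mechanism N D S} {cost : ∀ i, D i → S → ℝ} {k : ℕ∞}
    (h : Simulates M.strategy (fun _ => Set.univ) M.game T) (hT : T.IsRoundTable)
    (hM : M.KStepOSP cost k) : T.KStepOSP cost k := by
  refine (QueryTree.kStepOSP_iff hT).2 fun i u n part child hu a c hac o ho X' p' hc => ?_
  obtain ⟨hau, hcu, hac⟩ := (QueryTree.diverge_iff_of_sub hu).1 hac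
  obtain ⟨x, y, hxy, hax, hcy⟩ := QueryTree.diverge_query_nil_iff.1 hac
  obtain ⟨g, I, m, next, E, hg, hsim, hsep, hfollow⟩ := h.exists_history hu
  obtain ⟨haE, haf⟩ := hfollow a (fun _ _ => trivial) hau
  obtain ⟨hcE, hcf⟩ := hfollow c (fun _ _ => trivial) hcu
  have hI : M.game.InInfoSet i I g := ⟨m, next, hg⟩
  have hdeparture : M.game.EarliestDeparture i (M.strategy i (a i)) (M.strategy i (c i)) I :=
    ⟨⟨g, hI, haf i⟩, ⟨g, hI, hcf i⟩,
      fun J => M.isGame.perfect_recall.eq_of_earlier hI (haf i) (hcf i),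
      hsep x y hxy _ hax _ hcy⟩
  refine hM i (a i) _ (M.isStrategy i (c i)) I hdeparture o ?_ (X', p') ?_
  · exact GameTree.mem_outcomesFrom_iff.2
      ⟨g, m, next, hg, hsim.outcomes_subset (fun _ => haE i trivial) ho⟩
  · have hplay := hsim.mem_plays hcE ((hT.result_iff_of_sub hu hcu).1 hc)
    exact GameTree.mem_outcomesFrom_iff.2
      ⟨g, m, next, hg, GameTree.plays_subset_outcomes i _ _ _ hplay⟩

theorem implements {M : Mechanism N D S} {f : (∀ i, D i) → S}
    (h : Simulates M.strategy (fun _ => Set.univ) M.game T) (hT : T.IsRoundTable)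
    (hM : M.Implements f) : T.Implements f := by
  intro b
  obtain ⟨X, p, hr⟩ := hT.exists_result (b := b) fun _ _ => trivial
  obtain rfl : X = f b := hM b _ (h.mem_plays (fun _ _ => trivial) hr)
  exact ⟨p, hr⟩

end Simulates

end OSP

theorem mainTheorem7_general {N : Type*} {D : N → Type*} {S : Type*}
    (cost : ∀ i, D i → S → ℝ) (f : (∀ i, D i) → S) (k : ℕ∞) :
    (∃ M : OSP.Mechanism N D S, M.KStepOSP cost k ∧ M.Implements f) ↔
      (∃ T : OSP.QueryTree N D S, T.IsRoundTable ∧ T.KStepOSP cost k ∧ T.Implements f) := by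
  constructor
  · rintro ⟨M, hM, hf⟩
    obtain ⟨T, hsim, hT⟩ := OSP.exists_simulates M.strategy M.isGame.action_exists M.isStrategy
      (fun _ _ _ _ => M.isGame.chance_pos) fun _ => Set.univ
    exact ⟨T, hT, hsim.kStepOSP hT hM, hsim.implements hT hf⟩
  · rintro ⟨T, hT, hk, hf⟩
    by_cases hD : Nonempty (∀ i, D i)
    · exact ⟨T.toMechanism hT, hk.toMechanism hT, hf.toMechanism hT⟩
    -- Without type profiles an information set of the game of `T` can still be reached by both
    -- strategies of an agent while `k`-step OSP of `T` says nothing: use a leaf instead of `T`.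
    · obtain ⟨-, X, p, -⟩ := hT.exists_isLeaf
      exact ⟨_, OSP.QueryTree.kStepOSP_toMechanism_leaf X p cost k, fun t => (hD ⟨t⟩).elim⟩

theorem mainTheorem7 {N : Type*} [Finite N] {D : N → Type*} {S : Type*}
    (cost : ∀ i, D i → S → ℝ) (f : (∀ i, D i) → S) (k : ℕ∞) :
    (∃ M : OSP.Mechanism N D S, M.KStepOSP cost k ∧ M.Implements f) ↔
      (∃ T : OSP.QueryTree N D S, T.IsRoundTable ∧ T.KStepOSP cost k ∧ T.Implements f) :=
  mainTheorem7_general cost f k
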